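/- All spaces are regular and $T_1$. A space $G$ is \emph{rectifiable} if there are a homeomorphism $\varphi$ of $G\times G$ onto itself and a point $e\in G$ such that $\pi_1\circ\varphi=\pi_1$, where $\pi_1$ is the projection to the first coordinate, and $\varphi(x,x)=(x,e)$ for every $x\in G$. A family $\mathscr P$ of subsets of $G$ is a \emph{$k$-network} if for every compact $K\subset G$ and every open $U\supset K$ there is a finite $\mathscr P'\subset\mathscr P$ with $K\subset\bigcup\mathscr P'\subset U$; it is \emph{point-countable} if each point of $G$ lies in at most countably many members of $\mathscr P$. For $A\subset G$ put $[A]_0=A$, let $[A]_{\alpha+1}$ be the set of all limits of convergent sequences of points of $[A]_\alpha$, and let $[A]_\alpha=\bigcup_{\beta<\alpha}[A]_\beta$ for limit ordinals $\alpha$. The \emph{sequential order} of a sequential space $G$ is $$so(G)=\min\{\alpha\le\omega_1:\ \overline A=[A]_\alpha\ \text{for every } A\subset G\}.$$ \textbf{Theorem.} Let $G$ be a sequential rectifiable space with a point-countable $k$-network. If $so(G)<\omega_1$, then $G$ is metrizable. -/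

import Mathlib

open Set Filter Topology

/-- A space `G` is rectifiable if there are a homeomorphism `φ` of `G × G` onto itself and a point
`e` of `G` such that `φ` preserves first coordinates and `φ (x, x) = (x, e)` for every `x`. -/
def IsRectifiableSpace (G : Type*) [TopologicalSpace G] : Prop :=
  ∃ (φ : (G × G) ≃ₜ (G × G)) (e : G),
    (∀ z : G × G, (φ z).1 = z.1) ∧ ∀ x : G, φ (x, x) = (x, e)

/-- A family `P` of subsets of `X` is a `k`-network if, whenever `K` is compact, `U` is open and
`K ⊆ U`, there is a finite subfamily `F` of `P` with `K ⊆ ⋃₀ F ⊆ U`. -/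
def IsKNetwork {X : Type*} [TopologicalSpace X] (P : Set (Set X)) : Prop :=
  ∀ K U : Set X, IsCompact K → IsOpen U → K ⊆ U →
    ∃ F : Set (Set X), F ⊆ P ∧ F.Finite ∧ K ⊆ ⋃₀ F ∧ ⋃₀ F ⊆ U

/-- A family of subsets of `X` is point-countable if every point lies in at most countably many
of its members. -/
def IsPointCountable {X : Type*} (P : Set (Set X)) : Prop :=
  ∀ x : X, {A ∈ P | x ∈ A}.Countable

/-- The iterated sequential closure `[A]_α`: `[A]_0 = A`, `[A]_(α+1)` is the set of limits of
convergent sequences in `[A]_α`, and `[A]_α = ⋃_{β < α} [A]_β` for a limit ordinal `α`. -/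
noncomputable def iterSeqClosure {X : Type*} [TopologicalSpace X] (A : Set X)
    (α : Ordinal.{0}) : Set X :=
  Ordinal.limitRecOn α A (fun _ B => seqClosure B) (fun α _ B => ⋃ (β) (h : β < α), B β h)

/-- The sequential order: the least `α ≤ ω₁` such that `closure A = [A]_α` for every `A`.
In a sequential space `α = ω₁` has this property (see `closure_eq_iterSeqClosure_omega_one`),
so the infimum is a minimum. -/
noncomputable def sequentialOrder (X : Type*) [TopologicalSpace X] : Ordinal.{0} :=
  sInf {α : Ordinal.{0} | α ≤ Ordinal.omega 1 ∧ ∀ A : Set X, closure A = iterSeqClosure A α}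

theorem iterSeqClosure_zero {X : Type*} [TopologicalSpace X] (A : Set X) :
    iterSeqClosure A 0 = A := by
  simp [iterSeqClosure]

theorem iterSeqClosure_add_one {X : Type*} [TopologicalSpace X] (A : Set X) (α : Ordinal.{0}) :
    iterSeqClosure A (α + 1) = seqClosure (iterSeqClosure A α) := by
  simp [iterSeqClosure]

theorem iterSeqClosure_limit {X : Type*} [TopologicalSpace X] (A : Set X) {α : Ordinal.{0}}
    (hα : Order.IsSuccLimit α) : iterSeqClosure A α = ⋃ β < α, iterSeqClosure A β := by
  unfold iterSeqClosure
  rw [Ordinal.limitRecOn_limit _ _ _ _ hα]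

theorem iterSeqClosure_mono {X : Type*} [TopologicalSpace X] (A : Set X) {α β : Ordinal.{0}}
    (h : α ≤ β) : iterSeqClosure A α ⊆ iterSeqClosure A β := by
  induction β using Ordinal.limitRecOn with
  | zero => rw [nonpos_iff_eq_zero.1 h]
  | add_one β ih =>
    rcases h.eq_or_lt with rfl | h
    · exact subset_rfl
    · rw [iterSeqClosure_add_one]
      exact (ih (Order.lt_add_one_iff.1 h)).trans subset_seqClosure
  | limit β hβ ih =>
    rcases h.eq_or_lt with rfl | h
    · exact subset_rfl
    · rw [iterSeqClosure_limit A hβ]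
      exact subset_biUnion_of_mem (u := fun γ => iterSeqClosure A γ) h

theorem iterSeqClosure_subset_closure {X : Type*} [TopologicalSpace X] (A : Set X)
    (α : Ordinal.{0}) : iterSeqClosure A α ⊆ closure A := by
  induction α using Ordinal.limitRecOn with
  | zero => rw [iterSeqClosure_zero]; exact subset_closure
  | add_one α ih =>
    rw [iterSeqClosure_add_one]
    exact seqClosure_subset_closure.trans (closure_minimal ih isClosed_closure)
  | limit α hα ih =>
    rw [iterSeqClosure_limit A hα]
    exact iUnion₂_subset ih

theorem closure_eq_iterSeqClosure_omega_one {X : Type*} [TopologicalSpace X] [SequentialSpace X]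
    (A : Set X) : closure A = iterSeqClosure A (Ordinal.omega 1) := by
  have hlim : Order.IsSuccLimit (Ordinal.omega.{0} 1) := Cardinal.isSuccLimit_omega 1
  refine Subset.antisymm (closure_minimal ?_ ?_) (iterSeqClosure_subset_closure A _)
  · have h := iterSeqClosure_mono A (zero_le : 0 ≤ Ordinal.omega.{0} 1)
    rwa [iterSeqClosure_zero] at h
  · refine IsSeqClosed.isClosed fun x p hx hp => ?_
    have hx' : ∀ n, ∃ β < Ordinal.omega.{0} 1, x n ∈ iterSeqClosure A β := fun n => by
      have := hx n
      rw [iterSeqClosure_limit A hlim] at this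
      simpa using this
    choose β hβ hxβ using hx'
    have hsup : (⨆ n, β n) < Ordinal.omega.{0} 1 := Ordinal.iSup_lt_omega_one hβ
    refine iterSeqClosure_mono A (Order.add_one_le_of_lt hsup) ?_
    rw [iterSeqClosure_add_one]
    exact ⟨x, fun n => iterSeqClosure_mono A
      (le_ciSup (Ordinal.bddAbove_of_small (s := range β)) n) (hxβ n), hp⟩

/-- In a sequential space the sequential order is at most `ω₁`, and it has the property of which
it is the least instance. -/
theorem sequentialOrder_spec (X : Type*) [TopologicalSpace X] [SequentialSpace X] :
    sequentialOrder X ≤ Ordinal.omega 1 ∧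
      ∀ A : Set X, closure A = iterSeqClosure A (sequentialOrder X) :=
  csInf_mem (s := {α : Ordinal.{0} | α ≤ Ordinal.omega 1 ∧
      ∀ A : Set X, closure A = iterSeqClosure A α})
    ⟨_, le_rfl, fun A => closure_eq_iterSeqClosure_omega_one A⟩

/-!
Write the rectification of `G` through operations `p`, `q` with `p x (q x y) = y = q x (p x y)` and
`q x x = e`; in a group these are `x * y` and `x⁻¹ * y`. The proof distinguishes whether `e` has
diagonal sequences (`HasDiagonalSequences`): given sequences `S 0, S 1, …` converging to `e`, some
sequence converging to `e` takes its terms from pairwise different `S n`.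

If it does, `G` is a Fréchet–Urysohn space (`IsRectification.frechetUrysohnSpace`), and the
point-countable `k`-network gives a countable base at `e`
(`isCountablyGenerated_nhds_of_hasDiagonalSequences`). A first-countable rectifiable space is
metrizable (`IsRectification.metrizableSpace`), since its neighborhoods of the diagonal satisfy the
triangle inequality locally, which suffices by a classical theorem of Niemytzki and Frink
(`metrizableSpace_of_symmetric_local_triangle`).

If it does not, the sequential order is `ω₁`. Sequences without a diagonal are placed in a countable
set `A` closed under `p` and `q`. The members of the `k`-network that meet `A` form a countable
family, and every convergent sequence in `A` meets some member, inside a prescribed neighborhood of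
the limit, infinitely often. For some neighborhood `U` of `e` no finite union of members of this
family lying in `U` has a closure that absorbs all sequences in `A` converging to `e`
(`exists_isOpen_forall_exists_seq_notMem_closure`). Translates of sequences that avoid more and more
of these closures are arranged into a tree of points in which the children of a node converge to it
and no sequence running strictly below infinitely many different children of one node converges
(`IsRectification.exists_isSpreadTree`). Cutting this tree at well-founded subtrees of
arbitrary countable rank yields sets whose closure needs arbitrarily many iterations of the
sequential closure (`IsSpreadTree.exists_closure_ne_iterSeqClosure`).
-/

/-! ### Metrizability from a symmetric neighborhood assignment -/

/-- A symmetric, decreasing neighborhood assignment `E` such that, for each `x` and `n`, some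
`E m`-neighborhood of every point of `E m x` lies in `E n x`, makes the space metrizable. As `m`
depends on `x`, the sets `{(x, y) | y ∈ E n x}` need not generate a uniformity; the sets `D k`
below, in which the index is chosen separately at each center, do. -/
theorem metrizableSpace_of_symmetric_local_triangle {X : Type*} [TopologicalSpace X] [T0Space X]
    (E : ℕ → X → Set X) (hanti : ∀ x, Antitone fun n => E n x) (hnhds : ∀ n x, E n x ∈ 𝓝 x)
    (hbasis : ∀ x, ∀ U ∈ 𝓝 x, ∃ n, E n x ⊆ U) (hsymm : ∀ n x y, y ∈ E n x → x ∈ E n y)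
    (htri : ∀ x n, ∃ m, ∀ y ∈ E m x, E m y ⊆ E n x) :
    TopologicalSpace.MetrizableSpace X := by
  have hself : ∀ n x, x ∈ E n x := fun n x => mem_of_mem_nhds (hnhds n x)
  -- Three steps instead of two, in A. H. Frink's form: meeting neighborhoods are nested.
  have hfrink : ∀ x n, ∃ m, ∀ y w, w ∈ E m x → w ∈ E m y → E m y ⊆ E n x := by
    intro x n
    obtain ⟨m₁, h₁⟩ := htri x n
    obtain ⟨m₂, h₂⟩ := htri x m₁
    refine ⟨max m₁ m₂, fun y w hwx hwy z hz => ?_⟩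
    have hy : y ∈ E m₁ x := h₂ w (hanti x (le_max_right m₁ m₂) hwx)
      (hanti w (le_max_right m₁ m₂) (hsymm _ _ _ hwy))
    exact h₁ y hy (hanti y (le_max_left m₁ m₂) hz)
  choose μ hμ using hfrink
  -- `N k x` is the index of the `k`-th neighborhood used at the center `x`.
  let N : ℕ → X → ℕ := fun k x => Nat.rec 0 (fun i r => max (max (μ x r) r) (i + 1)) k
  have hNs : ∀ k x, N (k + 1) x = max (max (μ x (N k x)) (N k x)) (k + 1) := fun _ _ => rfl
  have hNmono : ∀ x, Monotone fun k => N k x := fun x => monotone_nat_of_le_succ fun k => by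
    rw [hNs]
    exact (le_max_right _ _).trans (le_max_left _ _)
  have hNle : ∀ k x, k ≤ N k x := by
    intro k x
    cases k with
    | zero => exact Nat.zero_le _
    | succ k => rw [hNs]; exact le_max_right _ _
  let D : ℕ → Set (X × X) := fun k => {z | ∃ c, z.1 ∈ E (N k c) c ∧ z.2 ∈ E (N k c) c}
  have hDanti : Antitone D := fun i j hij z ⟨c, h₁, h₂⟩ =>
    ⟨c, hanti c (hNmono c hij) h₁, hanti c (hNmono c hij) h₂⟩
  have hDcomp : ∀ k a b c, (a, b) ∈ D (k + 1) → (b, c) ∈ D (k + 1) → (a, c) ∈ D k := by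
    -- Of two meeting neighborhoods, the one with the larger index is absorbed by the other one.
    have key : ∀ k x y b, N (k + 1) x ≤ N (k + 1) y → b ∈ E (N (k + 1) x) x →
        b ∈ E (N (k + 1) y) y → E (N (k + 1) y) y ⊆ E (N k x) x := by
      intro k x y b hxy hbx hby z hz
      have hle : μ x (N k x) ≤ N (k + 1) x := by
        rw [hNs]; exact (le_max_left _ _).trans (le_max_left _ _)
      exact hμ x (N k x) y b (hanti x hle hbx) (hanti y (hle.trans hxy) hby)
        (hanti y (hle.trans hxy) hz)
    rintro k a b c ⟨x, hax, hbx⟩ ⟨y, hby, hcy⟩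
    rcases le_total (N (k + 1) x) (N (k + 1) y) with h | h
    · exact ⟨x, hanti x (hNmono x k.le_succ) hax, key k x y b h hbx hby hcy⟩
    · exact ⟨y, key k y x b h hby hbx hax, hanti y (hNmono y k.le_succ) hcy⟩
  have hB : (⨅ k, 𝓟 (D k)).HasBasis (fun _ => True) D :=
    hasBasis_iInf_principal hDanti.directed_ge
  let u : UniformSpace X :=
    { uniformity := ⨅ k, 𝓟 (D k)
      symm := (hB.tendsto_iff hB).2 fun k _ => ⟨k, trivial, fun z ⟨c, h₁, h₂⟩ => ⟨c, h₂, h₁⟩⟩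
      comp := ((hB.lift' (monotone_id.relComp monotone_id)).le_basis_iff hB).2 fun k _ =>
        ⟨k + 1, trivial, fun z ⟨b, h₁, h₂⟩ => hDcomp k z.1 b z.2 h₁ h₂⟩
      nhds_eq_comap_uniformity := by
        intro x
        ext U
        rw [(hB.comap (Prod.mk x)).mem_iff]
        constructor
        · intro hU
          obtain ⟨n, hn⟩ := hbasis x U hU
          obtain ⟨m, hm⟩ := htri x n
          refine ⟨m, trivial, fun y ⟨c, hx, hy⟩ => hn ?_⟩
          have hc : c ∈ E m x := hsymm _ _ _ (hanti c (hNle m c) hx)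
          exact hm c hc (hanti c (hNle m c) hy)
        · rintro ⟨k, -, hk⟩
          exact mem_of_superset (hnhds (N k x) x) fun y hy => hk ⟨x, hself _ _, hy⟩ }
  have : (uniformity X).IsCountablyGenerated := hB.isCountablyGenerated
  exact UniformSpace.metrizableSpace

/-! ### Rectifications -/

/-- The operations of a rectification: `p x` and `q x` are mutually inverse, both operations are
jointly continuous, and `q x x = e`. In a topological group one can take `p x y = x * y` and
`q x y = x⁻¹ * y`. -/
structure IsRectification {G : Type*} [TopologicalSpace G] (p q : G → G → G) (e : G) : Prop where
  continuous_p : Continuous fun z : G × G => p z.1 z.2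
  continuous_q : Continuous fun z : G × G => q z.1 z.2
  p_q : ∀ x y, p x (q x y) = y
  q_p : ∀ x y, q x (p x y) = y
  q_self : ∀ x, q x x = e

theorem IsRectifiableSpace.exists_isRectification {G : Type*} [TopologicalSpace G]
    (h : IsRectifiableSpace G) : ∃ (p q : G → G → G) (e : G), IsRectification p q e := by
  obtain ⟨φ, e, h₁, h₂⟩ := h
  have h₁' : ∀ z, (φ.symm z).1 = z.1 := fun z => by
    rw [← h₁ (φ.symm z), φ.apply_symm_apply]
  refine ⟨fun x y => (φ.symm (x, y)).2, fun x y => (φ (x, y)).2, e, ?_, ?_, ?_, ?_, ?_⟩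
  · exact continuous_snd.comp φ.symm.continuous
  · exact continuous_snd.comp φ.continuous
  · intro x y
    have : (x, (φ (x, y)).2) = φ (x, y) := Prod.ext (h₁ (x, y)).symm rfl
    simp only [this, φ.symm_apply_apply]
  · intro x y
    have : (x, (φ.symm (x, y)).2) = φ.symm (x, y) := Prod.ext (h₁' (x, y)).symm rfl
    simp only [this, φ.apply_symm_apply]
  · intro x
    simp only [h₂]

namespace IsRectification

variable {G : Type*} [TopologicalSpace G] {p q : G → G → G} {e : G}

theorem p_e (h : IsRectification p q e) (x : G) : p x e = x := by
  rw [← h.q_self x, h.p_q]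

theorem tendsto_p (h : IsRectification p q e) {ι : Type*} {l : Filter ι} {a b : ι → G} {x y : G}
    (ha : Tendsto a l (𝓝 x)) (hb : Tendsto b l (𝓝 y)) :
    Tendsto (fun i => p (a i) (b i)) l (𝓝 (p x y)) :=
  (h.continuous_p.tendsto (x, y)).comp (ha.prodMk_nhds hb)

theorem tendsto_q (h : IsRectification p q e) {ι : Type*} {l : Filter ι} {a b : ι → G} {x y : G}
    (ha : Tendsto a l (𝓝 x)) (hb : Tendsto b l (𝓝 y)) :
    Tendsto (fun i => q (a i) (b i)) l (𝓝 (q x y)) :=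
  (h.continuous_q.tendsto (x, y)).comp (ha.prodMk_nhds hb)

theorem continuous_q_left (h : IsRectification p q e) (x : G) : Continuous (q x) :=
  h.continuous_q.comp (Continuous.prodMk_right x)

theorem tendsto_p_nhds (h : IsRectification p q e) (x : G) : Tendsto (p x) (𝓝 e) (𝓝 x) := by
  have := h.tendsto_p (tendsto_const_nhds (x := x)) (tendsto_id (x := 𝓝 e))
  rwa [h.p_e] at this

/-- A first-countable rectifiable `T₀` space is metrizable: if `U n` is a decreasing base at `e`,
the relations `q x y ∈ U n ∧ q y x ∈ U n` satisfy the triangle inequality locally, because `p` is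
continuous at `(x, e)`. -/
theorem metrizableSpace [T0Space G] (h : IsRectification p q e) [(𝓝 e).IsCountablyGenerated] :
    TopologicalSpace.MetrizableSpace G := by
  obtain ⟨U, hU⟩ := (𝓝 e).exists_antitone_basis
  have hq : ∀ x (u : ℕ), {y | q x y ∈ U u} ∈ 𝓝 x := fun x u => by
    have := h.tendsto_q (tendsto_const_nhds (x := x)) (tendsto_id (x := 𝓝 x))
    rw [h.q_self] at this
    exact this (hU.mem u)
  have hq' : ∀ x (u : ℕ), {y | q y x ∈ U u} ∈ 𝓝 x := fun x u => by
    have := h.tendsto_q (tendsto_id (x := 𝓝 x)) (tendsto_const_nhds (x := x))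
    rw [h.q_self] at this
    exact this (hU.mem u)
  have hbasis : ∀ x, ∀ V ∈ 𝓝 x, ∃ n, {y | q x y ∈ U n ∧ q y x ∈ U n} ⊆ V := by
    intro x V hV
    obtain ⟨n, hn⟩ := hU.mem_iff.1 (h.tendsto_p_nhds x hV)
    refine ⟨n, fun y hy => ?_⟩
    have := hn hy.1
    rwa [mem_preimage, h.p_q] at this
  refine metrizableSpace_of_symmetric_local_triangle (fun n x => {y | q x y ∈ U n ∧ q y x ∈ U n})
    (fun x m n hmn y hy => ⟨hU.antitone hmn hy.1, hU.antitone hmn hy.2⟩)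
    (fun n x => inter_mem (hq x n) (hq' x n)) hbasis (fun n x y hy => ⟨hy.2, hy.1⟩) ?_
  intro x n
  have hp : Tendsto (fun z : G × G => p z.1 z.2) (𝓝 x ×ˢ 𝓝 e) (𝓝 x) := by
    have := h.continuous_p.tendsto (x, e)
    rwa [h.p_e, nhds_prod_eq] at this
  obtain ⟨V, hV, W, hW, hVW⟩ := mem_prod_iff.1 (hp (inter_mem (hq x n) (hq' x n)))
  obtain ⟨k, hk⟩ := hU.mem_iff.1 hW
  obtain ⟨l, hl⟩ := hbasis x V hV
  refine ⟨max k l, fun y hy z hz => ?_⟩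
  have hyV : y ∈ V := hl ⟨hU.antitone (le_max_right k l) hy.1, hU.antitone (le_max_right k l) hy.2⟩
  have : (y, q y z) ∈ V ×ˢ W := ⟨hyV, hk (hU.antitone (le_max_left k l) hz.1)⟩
  have hmem : p y (q y z) ∈ {w | q x w ∈ U n} ∩ {w | q w x ∈ U n} := hVW this
  rwa [h.p_q] at hmem

end IsRectification

/-! ### Countable closing off and `k`-networks -/

/-- If countably many points are produced from each finite set of points, every countable set lies
in a countable set that contains everything produced from its finite subsets. -/
theorem exists_countable_superset_closed {X : Type*} (Ψ : Finset X → Set X)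
    (hΨ : ∀ s, (Ψ s).Countable) {A : Set X} (hA : A.Countable) :
    ∃ C : Set X, C.Countable ∧ A ⊆ C ∧ ∀ s : Finset X, ↑s ⊆ C → Ψ s ⊆ C := by
  let T : ℕ → Set X := fun n =>
    Nat.rec A (fun _ B => B ∪ ⋃ s ∈ {s : Finset X | (s : Set X) ⊆ B}, Ψ s) n
  have hT : ∀ n, T (n + 1) = T n ∪ ⋃ s ∈ {s : Finset X | (s : Set X) ⊆ T n}, Ψ s := fun _ => rfl
  have hmono : Monotone T := monotone_nat_of_le_succ fun n => by
    rw [hT]; exact subset_union_left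
  have hcount : ∀ n, (T n).Countable := by
    intro n
    induction n with
    | zero => exact hA
    | succ n ih =>
      rw [hT]
      refine ih.union (Set.Countable.biUnion ?_ fun s _ => hΨ s)
      refine ((countable_ofPred_finite_subset ih).preimage_of_injOn
        (f := fun s : Finset X => (s : Set X)) Finset.coe_injective.injOn).mono ?_
      exact fun s hs => ⟨s.finite_toSet, hs⟩
  refine ⟨⋃ n, T n, countable_iUnion hcount, subset_iUnion T 0, fun s hs => ?_⟩
  obtain ⟨n, hn⟩ : ∃ n, (s : Set X) ⊆ T n := by
    obtain ⟨n, hn⟩ := hmono.directed_le.exists_mem_subset_of_finset_subset_biUnion hs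
    exact ⟨n, hn⟩
  refine Subset.trans ?_ (subset_iUnion T (n + 1))
  rw [hT]
  exact subset_union_of_subset_right (subset_biUnion_of_mem (u := fun s => Ψ s) hn) _

/-- A countable set is exhausted by finite subsets. -/
theorem Set.Countable.exists_finite_exhaustion {α : Type*} {S : Set α} (hS : S.Countable) :
    ∃ F : ℕ → Set α, (∀ n, (F n).Finite) ∧ (∀ n, F n ⊆ S) ∧ ∀ b ∈ S, ∀ᶠ n in atTop, b ∈ F n := by
  obtain ⟨f, hf⟩ := Set.countable_iff_exists_injOn.1 hS
  refine ⟨fun n => {b ∈ S | f b ≤ n}, fun n => ?_, fun n b hb => hb.1, fun b hb => ?_⟩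
  · exact Finite.of_finite_image ((finite_Iic n).subset (by rintro _ ⟨b, hb, rfl⟩; exact hb.2))
      (hf.mono fun b hb => hb.1)
  · exact (eventually_ge_atTop (f b)).mono fun n hn => ⟨hb, hn⟩

theorem IsPointCountable.countable_meeting {X : Type*} {P : Set (Set X)} (hP : IsPointCountable P)
    {C : Set X} (hC : C.Countable) : {B ∈ P | ∃ x ∈ C, x ∈ B}.Countable := by
  refine (hC.biUnion fun x _ => hP x).mono ?_
  rintro B ⟨hB, x, hx, hxB⟩
  exact mem_biUnion hx ⟨hB, hxB⟩

/-- Whenever a sequence converges to a point of an open set `O`, a single member of the `k`-network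
inside `O` contains infinitely many of its terms; it need not contain the limit. -/
theorem IsKNetwork.exists_frequently_mem {X : Type*} [TopologicalSpace X] {P : Set (Set X)}
    (hP : IsKNetwork P) {a : ℕ → X} {g : X} (ha : Tendsto a atTop (𝓝 g)) {O : Set X}
    (hO : IsOpen O) (hg : g ∈ O) : ∃ B ∈ P, B ⊆ O ∧ ∃ᶠ i in atTop, a i ∈ B := by
  obtain ⟨N, hN⟩ := eventually_atTop.1 (ha (hO.mem_nhds hg))
  have hK : IsCompact (insert g (range fun i => a (i + N))) :=
    ((tendsto_add_atTop_iff_nat N).2 ha).isCompact_insert_range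
  obtain ⟨F, hFP, hF, hKF, hFO⟩ := hP _ O hK hO <| by
    rintro _ (rfl | ⟨i, rfl⟩)
    · exact hg
    · exact hN _ (Nat.le_add_left N i)
  by_contra! hcon
  have hev : ∀ᶠ i in atTop, ∀ B ∈ F, a i ∉ B :=
    (eventually_all_finite hF).2 fun B hB =>
      hcon B (hFP hB) ((subset_sUnion_of_mem hB).trans hFO)
  obtain ⟨i, hi, hiN⟩ := (hev.and (eventually_ge_atTop N)).exists
  obtain ⟨B, hB, hiB⟩ : a i ∈ ⋃₀ F := hKF (Or.inr ⟨i - N, congrArg a (Nat.sub_add_cancel hiN)⟩)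
  exact hi B hB hiB

/-! ### Diagonal sequences and first countability -/

/-- For any sequences `s 0, s 1, …` converging to `e` there is a sequence converging to `e` whose
terms are taken from pairwise different `s n`. -/
def HasDiagonalSequences {X : Type*} [TopologicalSpace X] (e : X) : Prop :=
  ∀ s : ℕ → ℕ → X, (∀ n, Tendsto (s n) atTop (𝓝 e)) →
    ∃ n m : ℕ → ℕ, StrictMono n ∧ Tendsto (fun i => s (n i) (m i)) atTop (𝓝 e)

/-- Moving the last step of a two-step limit to `e` by `q` turns it into a family of sequences at
`e`; a diagonal of that family, moved back by `p`, is a one-step limit. -/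
theorem IsRectification.frechetUrysohnSpace {G : Type*} [TopologicalSpace G] [SequentialSpace G]
    {p q : G → G → G} {e : G} (h : IsRectification p q e) (hD : HasDiagonalSequences e) :
    FrechetUrysohnSpace G := by
  refine ⟨fun s => closure_minimal subset_seqClosure (IsSeqClosed.isClosed ?_)⟩
  intro x g hx hxg
  choose a ha hax using hx
  obtain ⟨n, m, hn, hnm⟩ := hD (fun n m => q (x n) (a n m)) fun n => by
    have := h.tendsto_q (tendsto_const_nhds (x := x n)) (hax n)
    rwa [h.q_self] at this
  refine ⟨fun i => a (n i) (m i), fun i => ha _ _, ?_⟩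
  have := h.tendsto_p (hxg.comp hn.tendsto_atTop) hnm
  simpa only [h.p_e, Function.comp_apply, h.p_q] using this

/-- A countable subfamily of the `k`-network suffices to give a base at `e`. The countable set `C`
is closed under the choice, for each finite union `M` of members meeting `C` that is not a
neighborhood of `e`, of a sequence outside `M` converging to `e`. If the finite unions inside an
open `U` were never neighborhoods, a diagonal of such sequences would escape every member of the
network that lies in `U`. -/
theorem isCountablyGenerated_nhds_of_hasDiagonalSequences {X : Type*} [TopologicalSpace X]
    [FrechetUrysohnSpace X] {e : X} (hD : HasDiagonalSequences e) {P : Set (Set X)}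
    (hP : IsKNetwork P) (hPc : IsPointCountable P) : (𝓝 e).IsCountablyGenerated := by
  -- `Φ M` is a sequence outside `M` converging to `e`, if there is one.
  have hΦ : ∀ M : Set X, ∃ a : ℕ → X, M ∉ 𝓝 e → (∀ i, a i ∉ M) ∧ Tendsto a atTop (𝓝 e) := by
    intro M
    by_cases hM : M ∈ 𝓝 e
    · exact ⟨fun _ => e, fun h => absurd hM h⟩
    · have he : e ∈ closure Mᶜ := by
        rw [closure_compl]
        exact fun h => hM (mem_interior_iff_mem_nhds.1 h)
      obtain ⟨a, ha, hae⟩ := mem_closure_iff_seq_limit.1 he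
      exact ⟨a, fun _ => ⟨ha, hae⟩⟩
  choose Φ hΦ using hΦ
  obtain ⟨C, hC, -, hCΦ⟩ := exists_countable_superset_closed
    (fun s : Finset X => ⋃ F ∈ {F : Set (Set X) | F.Finite ∧ F ⊆ {B ∈ P | ∃ x ∈ (s : Set X), x ∈ B}},
      range (Φ (⋃₀ F)))
    (fun s => (countable_ofPred_finite_subset
      (hPc.countable_meeting s.countable_toSet)).biUnion fun F _ => countable_range _)
    (countable_empty (α := X))
  have hclosed : ∀ F : Set (Set X), F.Finite → F ⊆ {B ∈ P | ∃ x ∈ C, x ∈ B} →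
      range (Φ (⋃₀ F)) ⊆ C := by
    intro F hF hFC
    have : Nonempty X := ⟨e⟩
    choose! x hxC hxB using fun B (hB : B ∈ F) => (hFC hB).2
    have hfin : (x '' F).Finite := hF.image x
    refine Subset.trans ?_ (hCΦ hfin.toFinset (by
      rw [hfin.coe_toFinset]; rintro _ ⟨B, hB, rfl⟩; exact hxC B hB))
    refine subset_biUnion_of_mem (u := fun F => range (Φ (⋃₀ F))) ⟨hF, fun B hB => ?_⟩
    refine ⟨(hFC hB).1, x B, ?_, hxB B hB⟩
    rw [hfin.coe_toFinset]
    exact mem_image_of_mem x hB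
  have hPC := hPc.countable_meeting hC
  have hbasis : (𝓝 e).HasCountableBasis
      (fun F : Set (Set X) => (F.Finite ∧ F ⊆ {B ∈ P | ∃ x ∈ C, x ∈ B}) ∧ ⋃₀ F ∈ 𝓝 e)
      (fun F => ⋃₀ F) := by
    refine ⟨⟨fun V => ⟨fun hV => ?_, fun ⟨F, hF, hFV⟩ => mem_of_superset hF.2 hFV⟩⟩,
      (countable_ofPred_finite_subset hPC).mono fun F hF => hF.1⟩
    obtain ⟨U, hUV, hU, heU⟩ := mem_nhds_iff.1 hV
    by_contra hcon
    obtain ⟨F, hFfin, hFsub, hFev⟩ :=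
      (hPC.mono (fun B (hB : B ∈ {B ∈ P | ∃ x ∈ C, x ∈ B} ∩ {B | B ⊆ U}) =>
        hB.1)).exists_finite_exhaustion
    have hnot : ∀ n, ⋃₀ F n ∉ 𝓝 e := fun n hn => hcon ⟨F n, ⟨⟨hFfin n, fun B hB =>
      (hFsub n hB).1⟩, hn⟩, sUnion_subset fun B hB => ((hFsub n hB).2.trans hUV)⟩
    obtain ⟨n, m, hn, hnm⟩ := hD (fun n => Φ (⋃₀ F n)) fun n => (hΦ _ (hnot n)).2
    obtain ⟨B, hBP, hBU, hB⟩ := hP.exists_frequently_mem hnm hU heU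
    obtain ⟨i, hi⟩ := hB.exists
    have hBC : B ∈ {B ∈ P | ∃ x ∈ C, x ∈ B} :=
      ⟨hBP, _, hclosed (F (n i)) (hFfin _) (fun B hB => (hFsub _ hB).1) ⟨m i, rfl⟩, hi⟩
    obtain ⟨j, hjB, hj⟩ :=
      (hB.and_eventually (hn.tendsto_atTop.eventually (hFev B ⟨hBC, hBU⟩))).exists
    exact (hΦ _ (hnot (n j))).1 (m j) ⟨B, hj, hjB⟩
  exact hbasis.isCountablyGenerated

/-! ### Sequences avoiding the closures of finite subfamilies -/

/-- Let `F n` be finite subfamilies of a countable family. If some sequences in `A` converging to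
`e` have no diagonal converging to `e`, there is a neighborhood `U` of `e` such that, for every `n`,
a nontrivial sequence in `A` converges to `e` off the closure of the union of those members of
`F n` that lie in `U`. Otherwise, by regularity, countably many of these closures would form a base
at `e` as far as sequences in `A` are concerned, and this would yield a diagonal. -/
theorem exists_isOpen_forall_exists_seq_notMem_closure {X : Type*} [TopologicalSpace X]
    [RegularSpace X] {e : X} {A : Set X} {S : Set (Set X)} (hS : S.Countable)
    {F : ℕ → Set (Set X)} (hF : ∀ n, (F n).Finite) (hFS : ∀ n, F n ⊆ S) {s : ℕ → ℕ → X}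
    (hsA : ∀ n m, s n m ∈ A) (hs : ∀ n, Tendsto (s n) atTop (𝓝 e))
    (hdiag : ¬∃ n m : ℕ → ℕ, StrictMono n ∧ Tendsto (fun i => s (n i) (m i)) atTop (𝓝 e)) :
    ∃ U, IsOpen U ∧ e ∈ U ∧ ∀ n, ∃ z : ℕ → X,
      (∀ m, z m ∈ A ∧ z m ≠ e ∧ z m ∉ closure (⋃₀ {B ∈ F n | B ⊆ U})) ∧
        Tendsto z atTop (𝓝 e) := by
  by_contra! hcon
  -- The finite subfamilies whose union has a closure that, together with `e`, is a neighborhood of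
  -- `e` as seen by sequences in `A`.
  let 𝒯 : Set (Set (Set X)) := {T | (T.Finite ∧ T ⊆ S) ∧ ∀ a : ℕ → X, (∀ i, a i ∈ A) →
    Tendsto a atTop (𝓝 e) → ∀ᶠ i in atTop, a i ∈ insert e (closure (⋃₀ T))}
  obtain ⟨𝒢, h𝒢fin, h𝒢sub, h𝒢ev⟩ := ((countable_ofPred_finite_subset hS).mono
    (fun T (hT : T ∈ 𝒯) => hT.1)).exists_finite_exhaustion
  have hm : ∀ n, ∃ m, ∀ T ∈ 𝒢 n, s n m ∈ insert e (closure (⋃₀ T)) := fun n =>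
    ((eventually_all_finite (h𝒢fin n)).2 fun T hT =>
      (h𝒢sub n hT).2 (s n) (hsA n) (hs n)).exists
  choose m hm using hm
  refine hdiag ⟨id, m, strictMono_id, ?_⟩
  intro V hV
  obtain ⟨K, hK, hKc, hKV⟩ := exists_mem_nhds_isClosed_subset hV
  obtain ⟨n, hn⟩ := hcon (interior K) isOpen_interior (mem_interior_iff_mem_nhds.2 hK)
  have hT : {B ∈ F n | B ⊆ interior K} ∈ 𝒯 := by
    refine ⟨⟨(hF n).subset fun B hB => hB.1, fun B hB => hFS n hB.1⟩, fun a haA hae => ?_⟩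
    by_contra hfreq
    obtain ⟨φ, hφ, hφa⟩ := extraction_of_frequently_atTop (not_eventually.1 hfreq)
    refine hn (a ∘ φ) (fun i => ⟨haA _, fun h => hφa i (Or.inl h), fun h => hφa i (Or.inr h)⟩)
      (hae.comp hφ.tendsto_atTop)
  refine mem_map.2 ?_
  filter_upwards [h𝒢ev _ hT] with i hi
  refine hKV ?_
  rcases hm i _ hi with h | h
  · change s i (m i) ∈ K
    rw [h]; exact mem_of_mem_nhds hK
  · exact closure_minimal (sUnion_subset fun B hB => hB.2.trans interior_subset) hKc h

/-! ### Spread trees -/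

/-- A tree of points indexed by finite sequences of naturals, with the most recent entry at the
head of the list: the children of each node converge to it, no other node takes the value of the
root, and no sequence of nodes lying strictly below children `k i :: τ` of a fixed node, with
`k i → ∞`, converges at all. -/
structure IsSpreadTree {X : Type*} [TopologicalSpace X] (x : List ℕ → X) : Prop where
  tendsto : ∀ σ, Tendsto (fun m => x (m :: σ)) atTop (𝓝 (x σ))
  ne_root : ∀ σ, σ ≠ [] → x σ ≠ x []
  not_tendsto : ∀ (τ : List ℕ) (σ : ℕ → List ℕ) (k : ℕ → ℕ) (g : X), Tendsto k atTop atTop →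
    (∀ i, (k i :: τ) <:+ σ i) → (∀ i, σ i ≠ k i :: τ) → ¬Tendsto (fun i => x (σ i)) atTop (𝓝 g)

theorem List.IsSuffix.exists_cons {α : Type*} {l l' : List α} (h : l <:+ l') (hne : l' ≠ l) :
    ∃ a, (a :: l) <:+ l' := by
  obtain ⟨t, rfl⟩ := h
  rcases List.eq_nil_or_concat t with rfl | ⟨t, a, rfl⟩
  · exact absurd rfl hne
  · exact ⟨a, t, by simp⟩

namespace IsRectification

variable {G : Type*} [TopologicalSpace G] {p q : G → G → G} {e : G}

/-- The node `y m` over `x` is the translate of `z m` to `x`. Its open set `V m` is small enough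
that the translates back to `e` of its points avoid the closure of `M`, and that it misses the
closures of those members of `F m` whose closure does not contain `y m`. -/
theorem exists_children [T1Space G] (h : IsRectification p q e) {A : Set G}
    (hA : ∀ a ∈ A, ∀ b ∈ A, p a b ∈ A) {F : ℕ → Set (Set G)} (hF : ∀ n, (F n).Finite)
    {M : Set G} {z : ℕ → G} (hz : ∀ m, z m ∈ A ∧ z m ≠ e ∧ z m ∉ closure M)
    (hze : Tendsto z atTop (𝓝 e)) {x : G} {W : Set G} (hxA : x ∈ A) (hxW : x ∈ W)
    (hW : IsOpen W) :
    ∃ (y : ℕ → G) (V : ℕ → Set G), (∀ m, y m ∈ A ∧ y m ∈ V m ∧ IsOpen (V m)) ∧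
      Tendsto y atTop (𝓝 x) ∧ (∀ m, V m ⊆ W) ∧ (∀ m, x ∉ V m) ∧
      (∀ m, ∀ w ∈ V m, q x w ∉ closure M) ∧
      ∀ m, ∀ B ∈ F m, y m ∉ closure B → Disjoint (V m) (closure B) := by
  have hlim : Tendsto (fun m => p x (z m)) atTop (𝓝 x) := (h.tendsto_p_nhds x).comp hze
  obtain ⟨N, hN⟩ := eventually_atTop.1 (hlim (hW.mem_nhds hxW))
  let y : ℕ → G := fun m => p x (z (m + N))
  have hyx : ∀ m, y m ≠ x := fun m hm => (hz (m + N)).2.1 <| by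
    rw [← h.q_p x (z (m + N)), ← h.q_self x]; exact congrArg (q x) hm
  refine ⟨y, fun m => ((W ∩ {x}ᶜ) ∩ q x ⁻¹' (closure M)ᶜ) ∩
    ⋂ B ∈ {B ∈ F m | y m ∉ closure B}, (closure B)ᶜ, ?_, ?_, ?_, ?_, ?_, ?_⟩
  · intro m
    refine ⟨hA _ hxA _ (hz _).1, ⟨⟨⟨hN _ (Nat.le_add_left N m), hyx m⟩, ?_⟩, ?_⟩, ?_⟩
    · rw [mem_preimage, h.q_p]; exact (hz _).2.2
    · exact mem_iInter₂.2 fun B hB => hB.2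
    · refine ((hW.inter isOpen_compl_singleton).inter
        (isClosed_closure.isOpen_compl.preimage (h.continuous_q_left x))).inter ?_
      exact ((hF m).subset fun B hB => hB.1).isOpen_biInter fun B _ =>
        isClosed_closure.isOpen_compl
  · exact hlim.comp (tendsto_add_atTop_nat N)
  · exact fun m w hw => hw.1.1.1
  · exact fun m hx => hx.1.1.2 rfl
  · exact fun m w hw => hw.1.2
  · exact fun m B hB hyB => disjoint_left.2 fun w hw => mem_iInter₂.1 hw.2 B ⟨hB, hyB⟩

/-- The nodes below `k :: τ` come from the sequence `z k`, so their translates back to `e` avoid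
the members of `F k` inside `U`. Hence nodes strictly below `k i :: τ`, with `k i → ∞`, cannot
converge to `x τ`, for then the translates would converge to `q (x τ) (x τ) = e`. They cannot
converge elsewhere because the subtrees at `k :: τ` avoid more and more members of the network. -/
theorem exists_isSpreadTree [T3Space G] (h : IsRectification p q e) {A : Set G} (he : e ∈ A)
    (hpA : ∀ a ∈ A, ∀ b ∈ A, p a b ∈ A) (hqA : ∀ a ∈ A, ∀ b ∈ A, q a b ∈ A)
    {F : ℕ → Set (Set G)} (hF : ∀ n, (F n).Finite)
    (hnet : ∀ (a : ℕ → G) (g : G) (O : Set G), (∀ i, a i ∈ A) → Tendsto a atTop (𝓝 g) →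
      IsOpen O → g ∈ O → ∃ B ⊆ O, (∀ᶠ n in atTop, B ∈ F n) ∧ ∃ᶠ i in atTop, a i ∈ B)
    {U : Set G} (hU : IsOpen U) (heU : e ∈ U)
    (hz : ∀ n, ∃ z : ℕ → G,
      (∀ m, z m ∈ A ∧ z m ≠ e ∧ z m ∉ closure (⋃₀ {B ∈ F n | B ⊆ U})) ∧
        Tendsto z atTop (𝓝 e)) :
    ∃ x : List ℕ → G, IsSpreadTree x := by
  choose z hz hze using hz
  -- A state is a node together with an open set that will contain its whole subtree.
  let St := {s : G × Set G // s.1 ∈ A ∧ s.1 ∈ s.2 ∧ IsOpen s.2}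
  choose y V hyV hy hVW hxV hVM hVF using fun (s : St) (n : ℕ) =>
    h.exists_children hpA hF (hz n) (hze n) s.2.1 s.2.2.1 s.2.2.2
  let st : List ℕ → St := fun σ => List.rec ⟨(e, univ), he, mem_univ _, isOpen_univ⟩
    (fun m σ s => ⟨(y s (σ.headD 0) m, V s (σ.headD 0) m), hyV s (σ.headD 0) m⟩) σ
  let x : List ℕ → G := fun σ => (st σ).1.1
  let W : List ℕ → Set G := fun σ => (st σ).1.2
  have hxA : ∀ σ, x σ ∈ A := fun σ => (st σ).2.1
  have hxW : ∀ σ, x σ ∈ W σ := fun σ => (st σ).2.2.1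
  have hWsub : ∀ m σ, W (m :: σ) ⊆ W σ := fun m σ => hVW (st σ) (σ.headD 0) m
  have hxnot : ∀ m σ, x σ ∉ W (m :: σ) := fun m σ => hxV (st σ) (σ.headD 0) m
  have hlim : ∀ σ, Tendsto (fun m => x (m :: σ)) atTop (𝓝 (x σ)) := fun σ => hy (st σ) (σ.headD 0)
  have hWM : ∀ m k τ, ∀ w ∈ W (m :: k :: τ),
      q (x (k :: τ)) w ∉ closure (⋃₀ {B ∈ F k | B ⊆ U}) := fun m k τ => hVM (st (k :: τ)) k m
  have hWF : ∀ m τ, ∀ B ∈ F m, x (m :: τ) ∉ closure B → Disjoint (W (m :: τ)) (closure B) :=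
    fun m τ => hVF (st τ) (τ.headD 0) m
  have hWsuf : ∀ τ σ, τ <:+ σ → W σ ⊆ W τ := by
    intro τ σ hτσ
    induction σ with
    | nil => rw [List.suffix_nil.1 hτσ]
    | cons m σ ih =>
      rcases List.suffix_cons_iff.1 hτσ with rfl | h'
      · exact subset_rfl
      · exact (hWsub m σ).trans (ih h')
  refine ⟨x, hlim, fun σ hσ heq => ?_, fun τ σ k g hk hsuf hne hg => ?_⟩
  · obtain ⟨m, hm⟩ := List.IsSuffix.exists_cons (List.nil_suffix (l := σ)) hσ
    exact hxnot m [] (heq ▸ hWsuf _ _ hm (hxW σ))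
  have hkτ : Tendsto (fun i => x (k i :: τ)) atTop (𝓝 (x τ)) := (hlim τ).comp hk
  by_cases hgτ : g = x τ
  · subst hgτ
    have hw : Tendsto (fun i => q (x (k i :: τ)) (x (σ i))) atTop (𝓝 e) := by
      have := h.tendsto_q hkτ hg
      rwa [h.q_self] at this
    obtain ⟨B, hBU, hBF, hB⟩ := hnet _ e U
      (fun i => hqA _ (hxA (k i :: τ)) _ (hxA (σ i))) hw hU heU
    obtain ⟨i, hiB, hiF⟩ := (hB.and_eventually (hk.eventually hBF)).exists
    obtain ⟨m, hm⟩ := (hsuf i).exists_cons (hne i)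
    exact hWM m (k i) τ _ (hWsuf _ _ hm (hxW (σ i))) (subset_closure ⟨B, ⟨hiF, hBU⟩, hiB⟩)
  · obtain ⟨K, hK, hKc, hKτ⟩ := exists_mem_nhds_isClosed_subset
      (isOpen_compl_singleton.mem_nhds (show g ∈ ({x τ}ᶜ : Set G) from hgτ))
    obtain ⟨B, hBK, hBF, hB⟩ := hnet _ g (interior K) (fun i => hxA (σ i)) hg isOpen_interior
      (mem_interior_iff_mem_nhds.2 hK)
    have hτB : x τ ∉ closure B := fun hx =>
      hKτ (closure_minimal (hBK.trans interior_subset) hKc hx) rfl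
    have hev : ∀ᶠ i in atTop, x (k i :: τ) ∉ closure B :=
      hkτ (isClosed_closure.isOpen_compl.mem_nhds hτB)
    obtain ⟨i, hiB, hiF, hi⟩ := (hB.and_eventually ((hk.eventually hBF).and hev)).exists
    exact disjoint_left.1 (hWF (k i) τ B hiF hi) (hWsuf _ _ (hsuf i) (hxW (σ i)))
      (subset_closure hiB)

/-- Sequences converging to `e` without a diagonal are placed in a countable set closed under `p`
and `q`; the members of the `k`-network meeting that set form a countable family. -/
theorem exists_isSpreadTree_of_not_hasDiagonalSequences [T3Space G] (h : IsRectification p q e)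
    (hD : ¬HasDiagonalSequences e) {P : Set (Set G)} (hP : IsKNetwork P)
    (hPc : IsPointCountable P) : ∃ x : List ℕ → G, IsSpreadTree x := by
  unfold HasDiagonalSequences at hD
  push Not at hD
  obtain ⟨s, hs, hdiag⟩ := hD
  obtain ⟨A, hA, hsub, hcl⟩ := exists_countable_superset_closed
    (fun t : Finset G => image2 p t t ∪ image2 q t t)
    (fun t => (t.countable_toSet.image2 t.countable_toSet p).union
      (t.countable_toSet.image2 t.countable_toSet q))
    ((countable_range fun i : ℕ × ℕ => s i.1 i.2).insert e)
  have hcl' : ∀ a ∈ A, ∀ b ∈ A, p a b ∈ A ∧ q a b ∈ A := by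
    classical
    intro a ha b hb
    have := hcl {a, b} (by simp [insert_subset_iff, ha, hb])
    exact ⟨this (Or.inl ⟨a, by simp, b, by simp, rfl⟩), this (Or.inr ⟨a, by simp, b, by simp, rfl⟩)⟩
  have hPA := hPc.countable_meeting hA
  obtain ⟨F, hFfin, hFsub, hFev⟩ := hPA.exists_finite_exhaustion
  obtain ⟨U, hU, heU, hz⟩ := exists_isOpen_forall_exists_seq_notMem_closure hPA hFfin hFsub
    (A := A) (fun n m => hsub (Or.inr ⟨(n, m), rfl⟩)) hs
    (fun ⟨n, m, hn, hnm⟩ => hdiag n m hn hnm)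
  refine h.exists_isSpreadTree (hsub (Or.inl rfl)) (fun a ha b hb => (hcl' a ha b hb).1)
    (fun a ha b hb => (hcl' a ha b hb).2) hFfin ?_ hU heU hz
  intro a g O haA hag hO hgO
  obtain ⟨B, hBP, hBO, hB⟩ := hP.exists_frequently_mem hag hO hgO
  obtain ⟨i, hi⟩ := hB.exists
  exact ⟨B, hBO, hFev B ⟨hBP, a i, haA i, hi⟩, hB⟩

end IsRectification

/-! ### The sequential order of a space with a spread tree -/

/-- A nonzero countable ordinal `β` is approached from below by ordinals `f k` so efficiently that
infinitely many of them are at most `δ` only when `β ≤ δ + 1`. -/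
theorem Ordinal.exists_seq_lt_of_lt_omega_one {β : Ordinal.{0}} (hβ : β < Ordinal.omega 1)
    (hβ0 : β ≠ 0) :
    ∃ f : ℕ → Ordinal.{0}, (∀ k, f k < β) ∧
      ∀ δ, (∃ᶠ k in atTop, f k ≤ δ) → β ≤ δ + 1 := by
  have hcount : (Iio β).Countable := by
    have hcard : β.card < Order.succ Cardinal.aleph0 := by
      rw [Cardinal.succ_aleph0]
      rwa [← Cardinal.ord_aleph, Cardinal.lt_ord] at hβ
    rw [← Cardinal.le_aleph0_iff_set_countable, Cardinal.mk_Iio_ordinal, Cardinal.lift_le_aleph0]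
    exact Order.lt_succ_iff.1 hcard
  obtain ⟨b, hb⟩ := hcount.exists_eq_range ⟨0, pos_iff_ne_zero.2 hβ0⟩
  have hbβ : ∀ i, b i < β := fun i => by
    have : b i ∈ Iio β := hb ▸ mem_range_self i
    exact this
  refine ⟨partialSups b, fun k => ?_, fun δ hδ => le_of_forall_lt fun η hη => ?_⟩
  · induction k with
    | zero => simpa using hbβ 0
    | succ k ih => rw [partialSups_add_one]; exact max_lt ih (hbβ _)
  · have : η ∈ range b := hb ▸ hη
    obtain ⟨i, rfl⟩ := this
    obtain ⟨k, hk, hkδ⟩ := (hδ.and_eventually (eventually_ge_atTop i)).exists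
    exact Order.lt_add_one_iff.2 ((le_partialSups_of_le b hkδ).trans hk)

/-- For a spread tree and a countable ordinal `γ`, the nodes are ranked
by ordinals starting from `γ + 1` at the root, and the tree is cut where the rank first vanishes.
The root is in the closure of the set of leaves, but `[leaves]_δ` contains only nodes of rank at
most `δ`. -/
theorem IsSpreadTree.exists_closure_ne_iterSeqClosure {X : Type*} [TopologicalSpace X] [T2Space X]
    {x : List ℕ → X} (hx : IsSpreadTree x) {γ : Ordinal.{0}} (hγ : γ < Ordinal.omega 1) :
    ∃ L : Set X, closure L ≠ iterSeqClosure L γ := by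
  have hf : ∀ β : Ordinal.{0}, ∃ f : ℕ → Ordinal.{0}, β < Ordinal.omega 1 → β ≠ 0 →
      (∀ k, f k < β) ∧ ∀ δ, (∃ᶠ k in atTop, f k ≤ δ) → β ≤ δ + 1 := by
    intro β
    by_cases hβ : β < Ordinal.omega 1 ∧ β ≠ 0
    · obtain ⟨f, hf⟩ := Ordinal.exists_seq_lt_of_lt_omega_one hβ.1 hβ.2
      exact ⟨f, fun _ _ => hf⟩
    · exact ⟨fun _ => 0, fun h₁ h₂ => absurd ⟨h₁, h₂⟩ hβ⟩
  choose f hf using hf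
  -- `ρ` is the rank, and `T` singles out the nodes of the cut tree.
  let ρ : List ℕ → Ordinal.{0} := fun σ => List.rec (γ + 1) (fun m _ r => f r m) σ
  let T : List ℕ → Prop := fun σ => List.rec True (fun _ σ t => t ∧ ρ σ ≠ 0) σ
  have hT : ∀ m σ, T (m :: σ) → T σ ∧ ρ σ ≠ 0 := fun _ _ h => h
  have hT' : ∀ m σ, T σ → ρ σ ≠ 0 → T (m :: σ) := fun _ _ h h' => ⟨h, h'⟩
  have hγ1 : γ + 1 < Ordinal.omega 1 := (Cardinal.isSuccLimit_omega 1).add_one_lt hγ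
  have hρω : ∀ σ, T σ → ρ σ < Ordinal.omega 1 := by
    intro σ
    induction σ with
    | nil => exact fun _ => hγ1
    | cons m σ ih =>
      intro h
      obtain ⟨h₁, h₂⟩ := hT m σ h
      exact ((hf (ρ σ) (ih h₁) h₂).1 m).trans (ih h₁)
  have hρlt : ∀ m σ, T σ → ρ σ ≠ 0 → ρ (m :: σ) < ρ σ := fun m σ h₁ h₂ =>
    (hf (ρ σ) (hρω σ h₁) h₂).1 m
  have hρlim : ∀ σ δ, T σ → ρ σ ≠ 0 → (∃ᶠ m in atTop, ρ (m :: σ) ≤ δ) → ρ σ ≤ δ + 1 :=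
    fun σ δ h₁ h₂ => (hf (ρ σ) (hρω σ h₁) h₂).2 δ
  have hTsuf : ∀ τ σ, τ <:+ σ → T σ → T τ := by
    intro τ σ hτσ h
    induction σ with
    | nil => rw [List.suffix_nil.1 hτσ]; trivial
    | cons m σ ih =>
      rcases List.suffix_cons_iff.1 hτσ with rfl | h'
      · exact h
      · exact ih h' (hT m σ h).1
  let L : Set X := x '' {σ | T σ ∧ ρ σ = 0}
  have hroot : ∀ α σ, ρ σ = α → T σ → x σ ∈ closure L := by
    intro α
    induction α using WellFoundedLT.induction with
    | ind α ih =>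
      rintro σ rfl h
      rcases eq_or_ne (ρ σ) 0 with h0 | h0
      · exact subset_closure ⟨σ, ⟨h, h0⟩, rfl⟩
      · exact isClosed_closure.mem_of_tendsto (hx.tendsto σ) (Eventually.of_forall fun m =>
          ih _ (hρlt m σ h h0) _ rfl (hT' m σ h h0))
  have hrank : ∀ δ, iterSeqClosure L δ ⊆ x '' {σ | T σ ∧ ρ σ ≤ δ} := by
    intro δ
    induction δ using Ordinal.limitRecOn with
    | zero =>
      rw [iterSeqClosure_zero]
      exact image_mono fun σ hσ => ⟨hσ.1, hσ.2.le⟩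
    | limit δ hδ ih =>
      rw [iterSeqClosure_limit L hδ]
      exact iUnion₂_subset fun β hβ => (ih β hβ).trans
        (image_mono fun σ hσ => ⟨hσ.1, hσ.2.trans hβ.le⟩)
    | add_one δ ih =>
      rw [iterSeqClosure_add_one]
      rintro g ⟨a, ha, hag⟩
      choose σ hσ hσa using fun i => ih (ha i)
      have hσg : Tendsto (fun i => x (σ i)) atTop (𝓝 g) := by simpa only [hσa] using hag
      -- A node of least rank below which infinitely many terms lie.
      obtain ⟨τ, ⟨hτT, hτ⟩, hmin⟩ := (InvImage.wf ρ (wellFounded_lt (α := Ordinal.{0}))).has_min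
        {τ | T τ ∧ ∃ᶠ i in atTop, τ <:+ σ i} ⟨[], trivial, Frequently.of_forall fun _ => List.nil_suffix⟩
      by_cases hconst : ∃ᶠ i in atTop, σ i = τ
      · obtain ⟨φ, hφ, hφτ⟩ := extraction_of_frequently_atTop hconst
        have hlim := hσg.comp hφ.tendsto_atTop
        simp only [Function.comp_def, hφτ] at hlim
        refine ⟨τ, ⟨hτT, ?_⟩, tendsto_nhds_unique tendsto_const_nhds hlim⟩
        exact (hφτ 0 ▸ (hσ (φ 0)).2).trans (le_self_add)
      obtain ⟨φ, hφ, hφτ⟩ := extraction_of_frequently_atTop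
        (hτ.and_eventually (not_frequently.1 hconst))
      -- Otherwise the terms lie below children `k i :: τ`; by minimality `k i → ∞`.
      choose k hk using fun i => (hφτ i).1.exists_cons (hφτ i).2
      have hkT : ∀ i, T (k i :: τ) := fun i => hTsuf _ _ (hk i) (hσ _).1
      have hτ0 : ρ τ ≠ 0 := (hT (k 0) τ (hkT 0)).2
      have hklim : Tendsto k atTop atTop := by
        refine tendsto_atTop.2 fun b => ?_
        have hev : ∀ᶠ i in atTop, ∀ m ∈ Iio b, k i ≠ m := by
          refine (eventually_all_finite (finite_Iio b)).2 fun m _ => not_frequently.1 fun hm => ?_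
          refine hmin (m :: τ) ⟨hT' m τ hτT hτ0, ?_⟩ (hρlt m τ hτT hτ0)
          exact hφ.tendsto_atTop.frequently (hm.mono fun i hi => hi ▸ hk i)
        exact hev.mono fun i hi => not_lt.1 fun hlt => hi (k i) hlt rfl
      by_cases hchild : ∃ᶠ i in atTop, σ (φ i) = k i :: τ
      · obtain ⟨ψ, hψ, hψτ⟩ := extraction_of_frequently_atTop hchild
        have hkψ := hklim.comp hψ.tendsto_atTop
        have hlim := hσg.comp (hφ.tendsto_atTop.comp hψ.tendsto_atTop)
        simp only [Function.comp_def, hψτ] at hlim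
        refine ⟨τ, ⟨hτT, ?_⟩, tendsto_nhds_unique ((hx.tendsto τ).comp hkψ) hlim⟩
        refine hρlim τ δ hτT hτ0 (hkψ.frequently (Frequently.of_forall fun i => ?_))
        have := (hσ (φ (ψ i))).2
        rwa [hψτ] at this
      · obtain ⟨N, hN⟩ := eventually_atTop.1 (not_frequently.1 hchild)
        refine absurd (hσg.comp (hφ.tendsto_atTop.comp (tendsto_add_atTop_nat N))) ?_
        exact hx.not_tendsto τ (fun i => σ (φ (i + N))) (fun i => k (i + N)) g
          (hklim.comp (tendsto_add_atTop_nat N)) (fun i => hk _)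
          (fun i => hN _ (Nat.le_add_left N i))
  refine ⟨L, fun h => ?_⟩
  obtain ⟨σ, ⟨-, hσ⟩, hσx⟩ := hrank γ (h ▸ hroot _ [] rfl trivial)
  have hnil : σ = [] := by_contra fun hne => hx.ne_root σ hne hσx
  subst hnil
  exact absurd hσ (not_le.2 (Order.lt_add_one_iff.2 le_rfl))

theorem mainTheorem6 {G : Type*} [TopologicalSpace G] [T3Space G] [SequentialSpace G]
    (hrect : IsRectifiableSpace G)
    (hnet : ∃ P : Set (Set G), IsKNetwork P ∧ IsPointCountable P)
    (hso : sequentialOrder G < Ordinal.omega 1) :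
    TopologicalSpace.MetrizableSpace G := by
  obtain ⟨p, q, e, h⟩ := hrect.exists_isRectification
  obtain ⟨P, hP, hPc⟩ := hnet
  by_cases hD : HasDiagonalSequences e
  · have := h.frechetUrysohnSpace hD
    have := isCountablyGenerated_nhds_of_hasDiagonalSequences hD hP hPc
    exact h.metrizableSpace
  · obtain ⟨x, hx⟩ := h.exists_isSpreadTree_of_not_hasDiagonalSequences hD hP hPc
    obtain ⟨L, hL⟩ := hx.exists_closure_ne_iterSeqClosure hso
    exact absurd ((sequentialOrder_spec G).2 L) hL
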